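/- Let $X$ be a finite simple graph with vertex set $V(X)$ that is vertex transitive, i.e. for all $x,y\in V(X)$ some automorphism of $X$ maps $x$ to $y$. Then $$\alpha_q(X)\,\omega_q(X)\le |V(X)| ,$$ where $\alpha_q$ and $\omega_q$ are the quantum independence number and the quantum clique number, defined as follows. For finite simple graphs $Z,Y$, a quantum strategy for the $(Z,Y)$-homomorphism game consists of natural numbers $d_A,d_B$, a unit vector $\psi\in\mathbb{C}^{d_A}\otimes\mathbb{C}^{d_B}$ and, for every $z\in V(Z)$, two POVMs $\{E_{zy}\}_{y\in V(Y)}$ on $\mathbb{C}^{d_A}$ and $\{F_{zy}\}_{y\in V(Y)}$ on $\mathbb{C}^{d_B}$ (positive semidefinite matrices with $\sum_y E_{zy}=I$ and $\sum_y F_{zy}=I$). The strategy wins if $\psi^*(E_{zy}\otimes F_{zy'})\psi=0$ for all $z$ and all $y\neq y'$, and $\psi^*(E_{zy}\otimes F_{z'y'})\psi=0$ whenever $z\sim z'$ in $Z$ and $y\not\sim y'$ in $Y$ (where $y\not\sim y'$ includes $y=y'$). Write $Z\xrightarrow{q}Y$ if a winning quantum strategy exists. Then $$\omega_q(X):=\max\{n\in\mathbb{N}: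 K_n\xrightarrow{q}X\},\qquad \alpha_q(X):=\omega_q(\overline{X}),$$ where $K_n$ is the complete graph on $n$ vertices and $\overline{X}$ is the complement of $X$; it is part of the claim that both maxima exist. -/

import Mathlib

open scoped Kronecker ComplexOrder

namespace QuantumHom

/-- A quantum strategy for a nonlocal game in which each of two players receives an input from `I`
and answers with an output from `O`. The players share a pure state `ψ ∈ ℂ^dA ⊗ ℂ^dB` (a unit
vector, written in coordinates). On input `x`, Alice measures her part with the POVM
`{E x y}_y`, and Bob measures his part with the POVM `{F x y}_y`. -/
structure QuantumStrategy (I O : Type*) [Fintype O] where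
  /-- dimension of Alice's system -/
  dA : ℕ
  /-- dimension of Bob's system -/
  dB : ℕ
  /-- the shared state -/
  ψ : Fin dA × Fin dB → ℂ
  /-- Alice's measurement operators -/
  E : I → O → Matrix (Fin dA) (Fin dA) ℂ
  /-- Bob's measurement operators -/
  F : I → O → Matrix (Fin dB) (Fin dB) ℂ
  unit_ψ : star ψ ⬝ᵥ ψ = 1
  posSemidef_E : ∀ x y, (E x y).PosSemidef
  posSemidef_F : ∀ x y, (F x y).PosSemidef
  sum_E : ∀ x, ∑ y, E x y = 1
  sum_F : ∀ x, ∑ y, F x y = 1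

/-- The probability `ψ* (E x y ⊗ F x' y') ψ` that Alice answers `y` and Bob answers `y'` when
they receive the inputs `x` and `x'` respectively. -/
def QuantumStrategy.prob {I O : Type*} [Fintype O] (S : QuantumStrategy I O)
    (x x' : I) (y y' : O) : ℂ :=
  star S.ψ ⬝ᵥ ((S.E x y ⊗ₖ S.F x' y').mulVec S.ψ)

/-- The strategy wins the `(X, Y)`-homomorphism game with probability one: every losing pair of
answers has probability zero. Equal inputs require equal answers, and adjacent inputs require
adjacent answers. -/
def QuantumStrategy.Wins {V W : Type*} [Fintype W] (S : QuantumStrategy V W)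
    (X : SimpleGraph V) (Y : SimpleGraph W) : Prop :=
  (∀ x y y', y ≠ y' → S.prob x x y y' = 0) ∧
  (∀ x x' y y', X.Adj x x' → ¬ Y.Adj y y' → S.prob x x' y y' = 0)

/-- There is a quantum homomorphism from `X` to `Y`: quantum players can win the
`(X, Y)`-homomorphism game. -/
def HasQuantumHom {V W : Type*} [Fintype W] (X : SimpleGraph V) (Y : SimpleGraph W) : Prop :=
  ∃ S : QuantumStrategy V W, S.Wins X Y

/-- The set of all `n` such that the complete graph `K_n` has a quantum homomorphism to `X`. -/
def quantumCliqueSizes {V : Type*} [Fintype V] (X : SimpleGraph V) : Set ℕ :=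
  {n | HasQuantumHom (⊤ : SimpleGraph (Fin n)) X}

/-- The quantum clique number `ω_q(X)`, the largest element of `quantumCliqueSizes X`. -/
noncomputable def quantumCliqueNumber {V : Type*} [Fintype V] (X : SimpleGraph V) : ℕ :=
  sSup (quantumCliqueSizes X)

/-- The quantum independence number `α_q(X)`, the quantum clique number of the complement. -/
noncomputable def quantumIndepNumber {V : Type*} [Fintype V] (X : SimpleGraph V) : ℕ :=
  quantumCliqueNumber Xᶜ

/-- A graph is vertex transitive if any vertex is mapped to any other by some automorphism. -/
def IsVertexTransitive {V : Type*} (X : SimpleGraph V) : Prop :=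
  ∀ x y : V, ∃ φ : X ≃g X, φ x = y

end QuantumHom

/-! A winning strategy for `K_n → X` yields vectors `u y`, orthogonal at distinct non-adjacent
vertices, with `⟨ψ, u y⟩ = ‖u y‖²` and `∑ ‖u y‖² = n`. A strategy for `K_m → Xᶜ` likewise yields `φ`
and `w y`, orthogonal at adjacent vertices. For each automorphism `g` the products `u (g y) ⊗ w y`
are therefore pairwise orthogonal, and a Bessel-type inequality against the unit vector `ψ ⊗ φ`
gives `∑ ‖u (g y)‖² ‖w y‖² ≤ 1`. By transitivity, the average of the left side over `g` is `n m /
|V|`. -/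

namespace QuantumHom

open Matrix

namespace QuantumStrategy

variable {V W : Type*} [Fintype W]

/-- Probability zero outcomes annihilate the state. -/
theorem mulVec_eq_zero_of_prob_eq_zero (S : QuantumStrategy V W) {x x' : V} {y y' : W}
    (h : S.prob x x' y y' = 0) : (S.E x y ⊗ₖ S.F x' y') *ᵥ S.ψ = 0 :=
  (((S.posSemidef_E x y).kronecker (S.posSemidef_F x' y')).dotProduct_mulVec_zero_iff S.ψ).1 h

theorem sum_kronecker_F (S : QuantumStrategy V W) (x x' : V) (y : W) :
    ∑ y', S.E x y ⊗ₖ S.F x' y' = S.E x y ⊗ₖ 1 := by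
  rw [← S.sum_F x']
  ext i j
  simp [Matrix.sum_apply, Finset.mul_sum]

theorem sum_E_kronecker (S : QuantumStrategy V W) (x x' : V) (y' : W) :
    ∑ y, S.E x y ⊗ₖ S.F x' y' = 1 ⊗ₖ S.F x' y' := by
  rw [← S.sum_E x]
  ext i j
  simp [Matrix.sum_apply, Finset.sum_mul]

/-- The unnormalised state after Alice answers `y` to the input `x`. -/
def aliceState (S : QuantumStrategy V W) (x : V) (y : W) : Fin S.dA × Fin S.dB → ℂ :=
  (S.E x y ⊗ₖ 1) *ᵥ S.ψ

/-- For a synchronous strategy, the two players' measurement operators act identically on the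
shared state. -/
theorem aliceState_eq (S : QuantumStrategy V W)
    (hS : ∀ x y y', y ≠ y' → S.prob x x y y' = 0) (x : V) (y : W) :
    S.aliceState x y = (1 ⊗ₖ S.F x y) *ᵥ S.ψ := by
  -- Inserting the other player's POVM on each side leaves only the diagonal term `(E x y ⊗ F x y)
  -- ψ`.
  rw [aliceState, ← S.sum_kronecker_F x x y, ← S.sum_E_kronecker x x y, sum_mulVec, sum_mulVec,
    Finset.sum_eq_single_of_mem y (Finset.mem_univ y), Finset.sum_eq_single_of_mem y
    (Finset.mem_univ y)]
  · exact fun y' _ h => S.mulVec_eq_zero_of_prob_eq_zero (hS x y' y h)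
  · exact fun y' _ h => S.mulVec_eq_zero_of_prob_eq_zero (hS x y y' h.symm)

/-- For a synchronous strategy, the outcome probabilities are inner products. -/
theorem star_aliceState_dotProduct (S : QuantumStrategy V W)
    (hS : ∀ x y y', y ≠ y' → S.prob x x y y' = 0) (x x' : V) (y y' : W) :
    star (S.aliceState x y) ⬝ᵥ S.aliceState x' y' = S.prob x x' y y' := by
  rw [S.aliceState_eq hS x' y', aliceState, star_mulVec, ← dotProduct_mulVec, mulVec_mulVec,
    conjTranspose_kronecker, (S.posSemidef_E x y).isHermitian.eq, conjTranspose_one,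
    ← mul_kronecker_mul, Matrix.mul_one, Matrix.one_mul, prob]

/-- The marginal probability of an answer in a synchronous strategy. -/
theorem star_dotProduct_aliceState (S : QuantumStrategy V W)
    (hS : ∀ x y y', y ≠ y' → S.prob x x y y' = 0) (x : V) (y : W) :
    star S.ψ ⬝ᵥ S.aliceState x y = S.prob x x y y := by
  rw [aliceState, ← S.sum_kronecker_F x x y, sum_mulVec, dotProduct_sum,
    Finset.sum_eq_single_of_mem y (Finset.mem_univ y)]
  · rfl
  · exact fun y' _ h => hS x y y' h.symm

theorem sum_aliceState (S : QuantumStrategy V W) (x : V) : ∑ y, S.aliceState x y = S.ψ := by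
  have h : ∑ y, S.E x y ⊗ₖ (1 : Matrix (Fin S.dB) (Fin S.dB) ℂ) = 1 := by
    rw [← one_kronecker_one, ← S.sum_E x]
    ext i j
    simp [Matrix.sum_apply, Finset.sum_mul]
  simp only [aliceState]
  rw [← sum_mulVec, h, one_mulVec]

end QuantumStrategy

/-- A winning strategy for `K_n → X` gives a unit vector `ψ` and a family of vectors indexed by the
vertices of `X`, orthogonal at distinct non-adjacent vertices, whose inner products with `ψ` are
their squared norms, which add up to `n`. -/
theorem exists_vectors_of_mem_quantumCliqueSizes {V : Type*} [Fintype V] {X : SimpleGraph V}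
    {n : ℕ} (hn : n ∈ quantumCliqueSizes X) :
    ∃ (a b : ℕ) (ψ : Fin a × Fin b → ℂ) (u : V → Fin a × Fin b → ℂ),
      star ψ ⬝ᵥ ψ = 1 ∧ (∀ y, star ψ ⬝ᵥ u y = star (u y) ⬝ᵥ u y) ∧
      (∀ y y', y ≠ y' → ¬ X.Adj y y' → star (u y) ⬝ᵥ u y' = 0) ∧
      ∑ y, star (u y) ⬝ᵥ u y = n := by
  obtain ⟨S, hS, hadj⟩ := hn
  have hinner : ∀ y y', star (∑ x, S.aliceState x y) ⬝ᵥ (∑ x, S.aliceState x y') =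
      ∑ x, ∑ x', S.prob x x' y y' := fun y y' => by
    simp only [star_sum, sum_dotProduct, dotProduct_sum, S.star_aliceState_dotProduct hS]
    exact Finset.sum_comm
  have hmarginal : ∀ y, star S.ψ ⬝ᵥ (∑ x, S.aliceState x y) =
      star (∑ x, S.aliceState x y) ⬝ᵥ (∑ x, S.aliceState x y) := fun y => by
    rw [hinner, dotProduct_sum]
    refine Finset.sum_congr rfl fun x _ => ?_
    -- Cross terms vanish: distinct inputs are adjacent in `K_n`, while `y` is not adjacent to
    -- itself.
    rw [S.star_dotProduct_aliceState hS, Finset.sum_eq_single_of_mem x (Finset.mem_univ x)]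
    exact fun x' _ h => hadj x x' y y h.symm (X.loopless.irrefl y)
  refine ⟨S.dA, S.dB, S.ψ, fun y => ∑ x, S.aliceState x y, S.unit_ψ, hmarginal,
    fun y y' hne hnadj => ?_, ?_⟩
  · rw [hinner]
    refine Finset.sum_eq_zero fun x _ => Finset.sum_eq_zero fun x' _ => ?_
    by_cases hx : x = x'
    · exact hx ▸ hS x y y' hne
    · exact hadj x x' y y' hx hnadj
  -- The total becomes `⟨ψ, ∑ x, ∑ y, aliceState x y⟩ = ⟨ψ, n ψ⟩`.
  · simp_rw [← hmarginal]
    rw [← dotProduct_sum, Finset.sum_comm]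
    simp only [S.sum_aliceState, Finset.sum_const, Finset.card_univ, Fintype.card_fin]
    rw [dotProduct_smul, S.unit_ψ, nsmul_eq_mul, mul_one]

/-- Inner products of product vectors. -/
theorem star_mul_dotProduct_mul {ι κ : Type*} [Fintype ι] [Fintype κ] (u u' : ι → ℂ)
    (w w' : κ → ℂ) :
    star (fun p : ι × κ => u p.1 * w p.2) ⬝ᵥ (fun p : ι × κ => u' p.1 * w' p.2) =
      (star u ⬝ᵥ u') * (star w ⬝ᵥ w') := by
  simp only [dotProduct, Fintype.sum_prod_type, Finset.sum_mul_sum, Pi.star_apply, star_mul']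
  exact Finset.sum_congr rfl fun i _ => Finset.sum_congr rfl fun j _ => by ring

/-- If two families of vectors have complementary orthogonality and both have inner products with
unit vectors equal to their squared norms, then the squared norms `a`, `b` satisfy
`∑ a y * b y ≤ 1`. -/
theorem sum_mul_le_one_of_orthogonal {V ι κ : Type*} [Fintype V] [Fintype ι] [Fintype κ]
    (ψ : ι → ℂ) (u : V → ι → ℂ) (φ : κ → ℂ) (w : V → κ → ℂ)
    (hψ : star ψ ⬝ᵥ ψ = 1) (hφ : star φ ⬝ᵥ φ = 1)
    (hu : ∀ y, star ψ ⬝ᵥ u y = star (u y) ⬝ᵥ u y)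
    (hw : ∀ y, star φ ⬝ᵥ w y = star (w y) ⬝ᵥ w y)
    (horth : ∀ y y', y ≠ y' → star (u y) ⬝ᵥ u y' = 0 ∨ star (w y) ⬝ᵥ w y' = 0) :
    ∑ y, (star (u y) ⬝ᵥ u y) * (star (w y) ⬝ᵥ w y) ≤ 1 := by
  have hu' : ∀ y, star (u y) ⬝ᵥ ψ = star (u y) ⬝ᵥ u y := fun y =>
    (star_dotProduct (u y) ψ).trans
      ((congrArg star (hu y)).trans (star_dotProduct (u y) (u y)).symm)
  have hw' : ∀ y, star (w y) ⬝ᵥ φ = star (w y) ⬝ᵥ w y := fun y =>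
    (star_dotProduct (w y) φ).trans
      ((congrArg star (hw y)).trans (star_dotProduct (w y) (w y)).symm)
  -- With `s` the sum to be bounded, this squared norm expands to `s - s - s + 1 = 1 - s`.
  have h := dotProduct_star_self_nonneg
    ((∑ y, fun p : ι × κ => u y p.1 * w y p.2) - fun p : ι × κ => ψ p.1 * φ p.2)
  have hdiag : ∀ y, ∑ y', (star (u y') ⬝ᵥ u y) * (star (w y') ⬝ᵥ w y) =
      (star (u y) ⬝ᵥ u y) * (star (w y) ⬝ᵥ w y) := fun y =>
    Finset.sum_eq_single_of_mem y (Finset.mem_univ y) fun y' _ hne => by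
      rcases horth y' y hne with h0 | h0 <;> simp [h0]
  simp only [star_sub, star_sum, sub_dotProduct, dotProduct_sub, sum_dotProduct, dotProduct_sum,
    star_mul_dotProduct_mul, hu, hw, hu', hw', hψ, hφ, hdiag, mul_one, sub_self,
    sub_nonneg, Finset.sum_const_zero, sub_nonpos] at h
  exact h

/-- Averaging over the automorphism group of a vertex transitive graph. -/
theorem card_mul_sum_automorphisms {V : Type*} [Fintype V] {X : SimpleGraph V}
    [Fintype (X ≃g X)] (hX : IsVertexTransitive X) (a : V → ℂ) (y : V) :
    (Fintype.card V : ℂ) * ∑ g : X ≃g X, a (g y) = Fintype.card (X ≃g X) * ∑ z, a z := by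
  have hconst : ∀ z, ∑ g : X ≃g X, a (g z) = ∑ g : X ≃g X, a (g y) := fun z => by
    obtain ⟨h, rfl⟩ := hX y z
    exact Fintype.sum_equiv (Equiv.mulRight h) _ _ fun g => rfl
  calc (Fintype.card V : ℂ) * ∑ g : X ≃g X, a (g y)
      = ∑ z, ∑ g : X ≃g X, a (g z) := by
        rw [Finset.sum_congr rfl fun z _ => hconst z]
        simp
    _ = ∑ g : X ≃g X, ∑ z, a (g z) := Finset.sum_comm
    _ = Fintype.card (X ≃g X) * ∑ z, a z := by
        rw [Finset.sum_congr rfl fun g _ => Equiv.sum_comp g.toEquiv a]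
        simp

theorem mul_le_card_of_mem_quantumCliqueSizes {V : Type*} [Fintype V] {X : SimpleGraph V}
    (hX : IsVertexTransitive X) {n m : ℕ} (hn : n ∈ quantumCliqueSizes X)
    (hm : m ∈ quantumCliqueSizes Xᶜ) : m * n ≤ Fintype.card V := by
  classical
  obtain ⟨_, _, ψ, u, hψ, hu, huo, hun⟩ := exists_vectors_of_mem_quantumCliqueSizes hn
  obtain ⟨_, _, φ, w, hφ, hw, hwo, hwm⟩ := exists_vectors_of_mem_quantumCliqueSizes hm
  have : Fintype (X ≃g X) := Fintype.ofInjective _ RelIso.toEquiv_injective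
  have hle : ∀ g : X ≃g X,
      ∑ y, (star (u (g y)) ⬝ᵥ u (g y)) * (star (w y) ⬝ᵥ w y) ≤ 1 := fun g =>
    sum_mul_le_one_of_orthogonal ψ (fun y => u (g y)) φ w hψ hφ (fun y => hu (g y)) hw
      fun y y' hne => by
        -- Since `g` preserves non-adjacency, twisting `u` by `g` keeps it complementary to `w`.
        by_cases hadj : X.Adj y y'
        · exact Or.inr (hwo y y' hne fun h => (X.compl_adj y y').1 h |>.2 hadj)
        · exact Or.inl (huo _ _ (g.injective.ne hne) fun h => hadj (g.map_adj_iff.1 h))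
  have hsum : (Fintype.card V : ℂ) *
      ∑ g : X ≃g X, ∑ y, (star (u (g y)) ⬝ᵥ u (g y)) * (star (w y) ⬝ᵥ w y) =
      Fintype.card (X ≃g X) * (m * n) := by
    rw [Finset.sum_comm, ← hun, ← hwm, Finset.sum_mul, Finset.mul_sum, Finset.mul_sum]
    refine Finset.sum_congr rfl fun y _ => ?_
    rw [← Finset.sum_mul, ← mul_assoc,
      card_mul_sum_automorphisms hX (fun z => star (u z) ⬝ᵥ u z) y]
    ring
  have hcard : (Fintype.card (X ≃g X) : ℂ) * (m * n) ≤
      Fintype.card V * Fintype.card (X ≃g X) := by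
    rw [← hsum]
    refine mul_le_mul_of_nonneg_left ?_ (Nat.cast_nonneg _)
    refine (Finset.sum_le_sum fun g _ => hle g).trans ?_
    simp
  have hnat : Fintype.card (X ≃g X) * (m * n) ≤ Fintype.card (X ≃g X) * Fintype.card V := by
    rw [mul_comm _ (Fintype.card V)]
    exact_mod_cast hcard
  have : Nonempty (X ≃g X) := ⟨1⟩
  exact Nat.le_of_mul_le_mul_left hnat Fintype.card_pos

/-- A graph homomorphism is a quantum homomorphism. -/
theorem HasQuantumHom.of_hom {V W : Type*} [Fintype W] {X : SimpleGraph V} {Y : SimpleGraph W}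
    (f : X →g Y) : HasQuantumHom X Y := by
  classical
  have hpos : ∀ x y, (if f x = y then (1 : Matrix (Fin 1) (Fin 1) ℂ) else 0).PosSemidef :=
    fun x y => by
      split_ifs
      exacts [PosSemidef.one, PosSemidef.zero]
  refine ⟨⟨1, 1, fun _ => 1, fun x y => if f x = y then 1 else 0,
    fun x y => if f x = y then 1 else 0, by simp [dotProduct], hpos, hpos, by simp, by simp⟩,
    fun x y y' hne => ?_, fun x x' y y' hadj hnadj => ?_⟩
  · by_cases hy : f x = y
    · have hy' : f x ≠ y' := fun h => hne (hy.symm.trans h)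
      simp [QuantumStrategy.prob, hy']
    · simp [QuantumStrategy.prob, hy]
  · by_cases hy : f x = y
    · have hy' : f x' ≠ y' := fun h => hnadj (hy ▸ h ▸ f.map_adj hadj)
      simp [QuantumStrategy.prob, hy']
    · simp [QuantumStrategy.prob, hy]

theorem zero_mem_quantumCliqueSizes {V : Type*} [Fintype V] (X : SimpleGraph V) :
    0 ∈ quantumCliqueSizes X :=
  HasQuantumHom.of_hom ⟨Fin.elim0, fun {a} => a.elim0⟩

theorem one_mem_quantumCliqueSizes {V : Type*} [Fintype V] [Nonempty V] (X : SimpleGraph V) :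
    1 ∈ quantumCliqueSizes X :=
  HasQuantumHom.of_hom ⟨fun _ => Classical.arbitrary V,
    fun {a b} h => absurd (Subsingleton.elim a b) h.ne⟩

theorem IsVertexTransitive.compl {V : Type*} {X : SimpleGraph V} (hX : IsVertexTransitive X) :
    IsVertexTransitive Xᶜ := fun x y => by
  obtain ⟨g, hg⟩ := hX x y
  exact ⟨⟨g.toEquiv, fun {a b} => by
    simp [SimpleGraph.compl_adj, g.map_adj_iff]⟩, hg⟩

/-- Boundedness is the product inequality with `m = 1`, as `K_1` maps to any nonempty graph. If `V`
is empty, the sum of squared norms is empty, so `n = 0`. -/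
theorem isGreatest_quantumCliqueNumber {V : Type*} [Fintype V] {X : SimpleGraph V}
    (hX : IsVertexTransitive X) : IsGreatest (quantumCliqueSizes X) (quantumCliqueNumber X) := by
  have hbdd : BddAbove (quantumCliqueSizes X) := ⟨Fintype.card V, fun n hn => by
    rcases isEmpty_or_nonempty V with _ | _
    · obtain ⟨_, _, _, _, _, _, _, h⟩ := exists_vectors_of_mem_quantumCliqueSizes hn
      rw [Finset.univ_eq_empty, Finset.sum_empty] at h
      exact (Nat.cast_eq_zero.1 h.symm).le.trans (Nat.zero_le _)
    · simpa using mul_le_card_of_mem_quantumCliqueSizes hX hn (one_mem_quantumCliqueSizes Xᶜ)⟩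
  exact ⟨Nat.sSup_mem ⟨0, zero_mem_quantumCliqueSizes X⟩ hbdd, fun _ hn => le_csSup hbdd hn⟩

end QuantumHom

theorem mainTheorem10 {V : Type*} [Fintype V] (X : SimpleGraph V)
    (hX : QuantumHom.IsVertexTransitive X) :
    IsGreatest (QuantumHom.quantumCliqueSizes X) (QuantumHom.quantumCliqueNumber X) ∧
    IsGreatest (QuantumHom.quantumCliqueSizes Xᶜ) (QuantumHom.quantumIndepNumber X) ∧
    QuantumHom.quantumIndepNumber X * QuantumHom.quantumCliqueNumber X ≤ Fintype.card V :=
  have h := QuantumHom.isGreatest_quantumCliqueNumber hX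
  have h' := QuantumHom.isGreatest_quantumCliqueNumber hX.compl
  ⟨h, h', QuantumHom.mul_le_card_of_mem_quantumCliqueSizes hX h.1 h'.1⟩
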